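/- **Setting.** Let $d,c,c_{\mathcal F},c_{\mathcal B}\in\mathbb N$ be positive integers, let $\Omega\subset\mathbb R^d$ be a bounded domain (open and connected), $\Gamma\subseteq\partial\Omega$, and let $r_{\mathcal F},r_{\mathcal B}\in\mathbb N_0$. For unknowns $u:\overline\Omega\to\mathbb R^c$ consider a possibly nonlinear interior differential operator of order $r_{\mathcal F}$ and a boundary differential operator of order $r_{\mathcal B}$, given by arbitrary functions $F$, $B$ through $$\widehat{\mathcal F}(u)(z)=F\big(z,\{D^\beta u(z):|\beta|\le r_{\mathcal F}\}\big)\in\mathbb R^{c_{\mathcal F}},\ z\in\Omega,\qquad \widehat{\mathcal B}(u)(z)=B\big(z,\{D^\beta u(z):|\beta|\le r_{\mathcal B}\}\big)\in\mathbb R^{c_{\mathcal B}},\ z\in\Gamma,$$ where $D^\beta u(z)$ at $z\in\partial\Omega$ is the trace of $D^\beta u$, i.e. the limit of $D^\beta u(x)$ as $x\to z$, $x\in\Omega$. Let $\Omega^h\subset\Omega$ and $\Gamma^h\subset\Gamma$ be finite sets of $N_{\mathcal F}\ge1$ and $N_{\mathcal B}\ge1$ (distinct) points, let $\mathcal D^h\subseteq\Omega^h\cup\Gamma^h$,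 let $u^*:\mathcal D^h\to\mathbb R^c$ be data, let $\omega_{\mathcal F}^z,\omega_{\mathcal B}^z,\omega_{\mathcal D}^z\in\mathbb R$ be quadrature weights, $\alpha_{\mathcal F},\alpha_{\mathcal B},\alpha_{\mathcal D}\ge0$ and $\nu\in[1,\infty)$. With $|v|_\nu^\nu=\sum_i|v_i|^\nu$, the AD-PINN functional is $$\mathcal J^h(u)=\alpha_{\mathcal F}\sum_{z\in\Omega^h}\omega_{\mathcal F}^z\,|\widehat{\mathcal F}(u)(z)|_\nu^\nu+\alpha_{\mathcal B}\sum_{z\in\Gamma^h}\omega_{\mathcal B}^z\,|\widehat{\mathcal B}(u)(z)|_\nu^\nu+\alpha_{\mathcal D}\sum_{z\in\mathcal D^h}\omega_{\mathcal D}^z\,|u(z)-u^*(z)|_\nu^\nu .$$ Set $\ell:=N_{\mathcal F}(d+r_{\mathcal F})+N_{\mathcal B}(d+r_{\mathcal B})$ and let $\sigma\in C^{\ell-d}(\mathbb R,\mathbb R)$ be such that, for some $a\in\mathbb R$, $\sigma^{(k)}(a)\ne0$ for all $0\le k\le\ell-d$. A depth-2 network with $n$ hidden units is a function $f(x)=W_2\,\sigma(W_1x+b_1)+b_2$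 with $W_1\in\mathbb R^{n\times d}$, $b_1\in\mathbb R^n$, $W_2\in\mathbb R^{c\times n}$, $b_2\in\mathbb R^c$ and $\sigma$ applied componentwise; it has $n(d+1)+c(n+1)$ parameters. Let $\mathcal H$ be the set of restrictions to $\overline\Omega$ of all depth-2 networks with an arbitrary number $n\ge1$ of hidden units, and let $\mathcal H^M\subset\mathcal H$ be the set of those realizable with exactly $M$ parameters, where $$M=c\tbinom{\ell}{d}(d+1)+c\Big(c\tbinom{\ell}{d}+1\Big),$$ i.e. with $c\binom{\ell}{d}$ hidden units. **Claim.** If the unconstrained AD-PINN problem $\min_{u\in\mathcal H}\mathcal J^h(u)$ has a minimizer in $\mathcal H$, then there is a depth-2 network with exactly $c\binom{\ell}{d}$ hidden units whose restriction $u_\theta\in\mathcal H^M$ to $\overline\Omega$ is also a minimizer of $\mathcal J^h$ over $\mathcal H$. -/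

import Mathlib

open Filter Topology

/-- Euclidean space `ℝⁿ`. -/
abbrev Eucl (n : ℕ) : Type := EuclideanSpace ℝ (Fin n)

/-- Multi-indices `β ∈ ℕ₀ᵈ` with `|β| ≤ r`. -/
abbrev MultiIdx (d r : ℕ) : Type := {β : Fin d → ℕ // ∑ i, β i ≤ r}

noncomputable section

/-! ### Classical derivatives on the closure of an open set -/

/-- The partial derivative `∂ᵢ g`. -/
def partialDeriv {d c : ℕ} (i : Fin d) (g : Eucl d → Eucl c) : Eucl d → Eucl c :=
  fun x => lineDeriv ℝ g x (EuclideanSpace.single i (1 : ℝ))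

/-- The iterated partial derivative `D^β g = ∂₁^β₁ ⋯ ∂_d^β_d g`. -/
def multiDeriv {d c : ℕ} (β : Fin d → ℕ) (g : Eucl d → Eucl c) : Eucl d → Eucl c :=
  (List.finRange d).foldr (fun i h => (partialDeriv i)^[β i] h) g

open Classical in
/-- Extension by zero of a function on `closure Ω`. It only serves to apply `multiDeriv`, which is
evaluated at points of the open set `Ω` alone, where the extension plays no role. -/
def zeroExt {d c : ℕ} {Ω : Set (Eucl d)} (u : closure Ω → Eucl c) : Eucl d → Eucl c :=
  fun x => if h : x ∈ closure Ω then u ⟨x, h⟩ else 0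

open Classical in
/-- `D^β u (z)` for `u : closure Ω → ℝᶜ` (with `Ω` open): the classical derivative if `z ∈ Ω`; if
`z ∈ ∂Ω`, the trace of `D^β u` at `z`, that is, the limit of `D^β u (x)` as `x → z` in `Ω`. -/
def derivAt {d c : ℕ} {Ω : Set (Eucl d)} (β : Fin d → ℕ) (u : closure Ω → Eucl c)
    (z : Eucl d) : Eucl c :=
  if z ∈ Ω then multiDeriv β (zeroExt u) z
  else limUnder (𝓝[Ω] z) (multiDeriv β (zeroExt u))

/-- `|v|_ν^ν = ∑ᵢ |vᵢ|^ν`. -/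
def lpPow {n : ℕ} (ν : ℝ) (v : Eucl n) : ℝ := ∑ i, |v i| ^ ν

/-! ### Depth-2 neural networks -/

/-- The parameters (weights and biases) of a fully connected depth-2 network with input dimension
`d`, `n` hidden units and output dimension `c`. -/
structure ShallowNet (d n c : ℕ) where
  W₁ : Matrix (Fin n) (Fin d) ℝ
  b₁ : Fin n → ℝ
  W₂ : Matrix (Fin c) (Fin n) ℝ
  b₂ : Fin c → ℝ

/-- The realized function `f(x) = W₂ σ(W₁ x + b₁) + b₂`, with `σ` applied componentwise. -/
def ShallowNet.realize {d n c : ℕ} (σ : ℝ → ℝ) (θ : ShallowNet d n c) (x : Eucl d) : Eucl c :=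
  WithLp.toLp 2 (θ.W₂.mulVec (fun j => σ (θ.W₁.mulVec (fun i => x i) j + θ.b₁ j)) + θ.b₂)

/-- The restriction of the realized function to `closure Ω`. -/
def ShallowNet.onClosure {d n c : ℕ} (σ : ℝ → ℝ) (Ω : Set (Eucl d)) (θ : ShallowNet d n c) :
    closure Ω → Eucl c :=
  fun x => θ.realize σ x

/-- The number of weights and biases of a depth-2 network with layer widths `(d, n, c)`. -/
def numParams (d n c : ℕ) : ℕ := n * (d + 1) + c * (n + 1)

/-- The class `𝓗` of all functions on `closure Ω` realized by depth-2 networks with activation `σ`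
and an arbitrary positive number of hidden units. -/
def networkClass {d : ℕ} (c : ℕ) (Ω : Set (Eucl d)) (σ : ℝ → ℝ) : Set (closure Ω → Eucl c) :=
  {u | ∃ n : ℕ, 0 < n ∧ ∃ θ : ShallowNet d n c, u = θ.onClosure σ Ω}

/-- The class `𝓗^M` of those functions realized by depth-2 networks with exactly `M` parameters. -/
def networkClassOfSize {d : ℕ} (c : ℕ) (Ω : Set (Eucl d)) (σ : ℝ → ℝ) (M : ℕ) :
    Set (closure Ω → Eucl c) :=
  {u | ∃ n : ℕ, 0 < n ∧ numParams d n c = M ∧ ∃ θ : ShallowNet d n c, u = θ.onClosure σ Ω}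

/-! ### The AD-PINN problem -/

/-- The data of an AD-PINN problem for a boundary value problem `𝓕(u) = 0` in `Ω`, `𝓑(u) = 0` on
`Γ ⊆ ∂Ω`, with unknown `u : closure Ω → ℝᶜ` and differential operators
`𝓕(u)(z) = F(z, {D^β u(z) : |β| ≤ rF})`, `𝓑(u)(z) = B(z, {D^β u(z) : |β| ≤ rB})`. -/
structure ADPINN (d c cF cB : ℕ) where
  /-- the domain -/
  Ω : Set (Eucl d)
  isOpen : IsOpen Ω
  isConnected : IsConnected Ω
  isBounded : Bornology.IsBounded Ω
  /-- the part of the boundary carrying boundary conditions -/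
  Γ : Set (Eucl d)
  Γ_subset : Γ ⊆ frontier Ω
  /-- order of the interior operator -/
  rF : ℕ
  /-- order of the boundary operator -/
  rB : ℕ
  /-- local expression of the (possibly nonlinear) interior operator -/
  F : Eucl d → (MultiIdx d rF → Eucl c) → Eucl cF
  /-- local expression of the (possibly nonlinear) boundary operator -/
  B : Eucl d → (MultiIdx d rB → Eucl c) → Eucl cB
  /-- interior collocation points -/
  Ωh : Finset (Eucl d)
  Ωh_nonempty : Ωh.Nonempty
  Ωh_subset : (Ωh : Set (Eucl d)) ⊆ Ω
  /-- boundary collocation points -/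
  Γh : Finset (Eucl d)
  Γh_nonempty : Γh.Nonempty
  Γh_subset : (Γh : Set (Eucl d)) ⊆ Γ
  /-- locations of the observations -/
  Dh : Finset (Eucl d)
  Dh_subset : (Dh : Set (Eucl d)) ⊆ (Ωh : Set (Eucl d)) ∪ (Γh : Set (Eucl d))
  /-- observation data; only the values on `Dh` are used -/
  uObs : Eucl d → Eucl c
  /-- quadrature weights -/
  ωF : Eucl d → ℝ
  ωB : Eucl d → ℝ
  ωD : Eucl d → ℝ
  /-- weights of the three terms of the loss -/
  αF : ℝ
  αB : ℝ
  αD : ℝ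
  αF_nonneg : 0 ≤ αF
  αB_nonneg : 0 ≤ αB
  αD_nonneg : 0 ≤ αD
  /-- the exponent -/
  ν : ℝ
  one_le_ν : 1 ≤ ν

namespace ADPINN

variable {d c cF cB : ℕ} (P : ADPINN d c cF cB)

/-- The interior operator evaluated at `z`. -/
def interiorOp (u : closure P.Ω → Eucl c) (z : Eucl d) : Eucl cF :=
  P.F z (fun β => derivAt β.1 u z)

/-- The boundary operator evaluated at `z`. -/
def boundaryOp (u : closure P.Ω → Eucl c) (z : Eucl d) : Eucl cB :=
  P.B z (fun β => derivAt β.1 u z)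

/-- The value `u(z)` at a point of `closure Ω`. -/
def valueAt (u : closure P.Ω → Eucl c) (z : Eucl d) : Eucl c := zeroExt u z

/-- The AD-PINN functional `𝓙ʰ`. -/
def loss (u : closure P.Ω → Eucl c) : ℝ :=
  P.αF * ∑ z ∈ P.Ωh, P.ωF z * lpPow P.ν (P.interiorOp u z)
    + P.αB * ∑ z ∈ P.Γh, P.ωB z * lpPow P.ν (P.boundaryOp u z)
    + P.αD * ∑ z ∈ P.Dh, P.ωD z * lpPow P.ν (P.valueAt u z - P.uObs z)

/-- `u` solves the unconstrained AD-PINN problem `min_{u ∈ 𝓗} 𝓙ʰ(u)`. -/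
def Solves (σ : ℝ → ℝ) (u : closure P.Ω → Eucl c) : Prop :=
  u ∈ networkClass c P.Ω σ ∧ ∀ v ∈ networkClass c P.Ω σ, P.loss u ≤ P.loss v

/-- `ℓ = N_F (d + r_F) + N_B (d + r_B)`, with `N_F`, `N_B` the numbers of interior and boundary
collocation points. -/
def ell : ℕ := P.Ωh.card * (d + P.rF) + P.Γh.card * (d + P.rB)

end ADPINN

end

/-! The loss sees a function only through finitely many numbers per output component: the
derivatives at the collocation points, indexed by `JetIdx`. For a network, this jet is, up to the
output bias, a linear combination of the jets of its hidden units, which are vectors in `JetIdx →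
ℝ`. Hence some of the hidden units, at most as many as there are indices, span the jets of all of
them (`exists_comp_span_eq`). Keeping these units and the bias and solving for new output weights
preserves the loss (`exists_onClosure_loss_eq`), so a minimizer stays a minimizer. Stars and bars
together with superadditivity of `m ↦ m.choose d` bound the number of indices by `P.ell.choose d`
(`natCard_jetIdx_le`). -/

/-! ### Counting multi-indices and binomial estimates. -/

theorem card_sum_le_le_choose (d r : ℕ) (s : Finset (MultiIdx d r)) :
    s.card ≤ (d + r).choose d := by
  have hcard : Fintype.card (Sym (Fin (d + 1)) r) = (d + r).choose d := by
    rw [Sym.card_sym_eq_choose, Fintype.card_fin, Nat.choose_symm_add,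
      Nat.add_right_comm, Nat.add_sub_cancel]
  -- Stars and bars: the slack `r - ∑ i, β i`, added as an extra coordinate, turns `≤ r` into `= r`.
  let f : MultiIdx d r → {P : Fin (d + 1) → ℕ // ∑ i, P i = r} := fun β =>
    ⟨Fin.cons (r - ∑ i, β.1 i) β.1, by
      have := β.2
      simp only [Fin.sum_univ_succ, Fin.cons_zero, Fin.cons_succ]
      omega⟩
  have hf : Function.Injective f := by
    intro β γ h
    apply Subtype.ext
    have h1 := congrArg (fun P => Fin.tail P.1) h
    simpa [f] using h1
  have hinj : Function.Injective (fun β => (Sym.equivNatSumOfFintype (Fin (d + 1)) r).symm (f β)) :=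
    (Equiv.injective _).comp hf
  rw [← hcard, ← Finset.card_map ⟨_, hinj⟩]
  exact Finset.card_le_univ _

instance multiIdx_finite (d r : ℕ) : Finite (MultiIdx d r) := by
  by_contra h
  rw [not_finite_iff_infinite] at h
  obtain ⟨s, hs⟩ := Infinite.exists_subset_card_eq (MultiIdx d r) ((d + r).choose d + 1)
  have := card_sum_le_le_choose d r s
  omega

/-- There are at most `(d + r).choose d` multi-indices of order at most `r`. -/
theorem natCard_multiIdx_le (d r : ℕ) : Nat.card (MultiIdx d r) ≤ (d + r).choose d := by
  have := Fintype.ofFinite (MultiIdx d r)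
  rw [Nat.card_eq_fintype_card]
  exact card_sum_le_le_choose d r Finset.univ

/-- Vandermonde's identity, keeping only the terms `(d, 0)` and `(0, d)`, which are distinct because
`d ≥ 1`. -/
theorem choose_add_choose_le {d : ℕ} (hd : 1 ≤ d) (m n : ℕ) :
    m.choose d + n.choose d ≤ (m + n).choose d := by
  rw [Nat.add_choose_eq]
  have hne : ((d, 0) : ℕ × ℕ) ≠ (0, d) := by
    intro h
    have := congrArg Prod.fst h
    simp only at this
    omega
  have hsub : ({(d, 0), (0, d)} : Finset (ℕ × ℕ)) ⊆ Finset.HasAntidiagonal.antidiagonal d := by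
    intro x hx
    simp only [Finset.mem_insert, Finset.mem_singleton] at hx
    rcases hx with rfl | rfl <;> simp
  calc m.choose d + n.choose d
      = ∑ ij ∈ ({(d, 0), (0, d)} : Finset (ℕ × ℕ)), m.choose ij.1 * n.choose ij.2 := by
        rw [Finset.sum_pair hne]; simp
    _ ≤ _ := Finset.sum_le_sum_of_subset hsub

theorem mul_choose_le {d : ℕ} (hd : 1 ≤ d) (N m : ℕ) :
    N * m.choose d ≤ (N * m).choose d := by
  induction N with
  | zero => simp
  | succ N ih =>
    rw [Nat.succ_mul, Nat.succ_mul]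
    exact (Nat.add_le_add_right ih _).trans (choose_add_choose_le hd _ _)

/-! ### Selection of a spanning subfamily. -/

/-- From a finite nonempty family of vectors one can select, with repetitions, any number of
vectors that is at least the dimension so that the span does not change. -/
theorem exists_comp_span_eq {V : Type*} [AddCommGroup V] [Module ℝ V] [FiniteDimensional ℝ V]
    {n N : ℕ} (hn : 0 < n) (hN : Module.finrank ℝ V ≤ N) (Φ : Fin n → V) :
    ∃ τ : Fin N → Fin n,
      Submodule.span ℝ (Set.range Φ) ≤ Submodule.span ℝ (Set.range (Φ ∘ τ)) := by
  obtain ⟨f, hf, hspan, -⟩ := Submodule.exists_fun_fin_finrank_span_eq ℝ (Set.range Φ)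
  choose g hg using hf
  have hr := (Submodule.finrank_le (Submodule.span ℝ (Set.range Φ))).trans hN
  -- Slots beyond the rank are padded with copies of vector `0`, which exists because `0 < n`.
  refine ⟨fun l => if h : l.1 < _ then g ⟨l.1, h⟩ else ⟨0, hn⟩, ?_⟩
  refine hspan.ge.trans (Submodule.span_mono ?_)
  rintro _ ⟨k, rfl⟩
  refine ⟨⟨k.1, k.2.trans_le hr⟩, ?_⟩
  simp [hg]

/-! ### Derivatives and traces of networks. -/

namespace ShallowNet

variable {d n c : ℕ} (θ : ShallowNet d n c) (σ : ℝ → ℝ)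

/-- The pre-activation of the hidden unit `j`. -/
def preact (j : Fin n) (x : Eucl d) : ℝ := ∑ i, θ.W₁ j i * x i + θ.b₁ j

/-- A sum of ridge functions with profile `σ^(s)`, directions taken from the network `θ` and
output weights scaled by `p`, plus the output bias if `s = 0`. -/
noncomputable def ridge (p : Fin n → ℝ) (s : ℕ) (x : Eucl d) : Eucl c :=
  WithLp.toLp 2 (fun k => ∑ j, θ.W₂ k j * (p j * iteratedDeriv s σ (θ.preact j x))
    + if s = 0 then θ.b₂ k else 0)

/-- The derivative `D^β` of the hidden unit `j`. -/
noncomputable def unitDeriv (β : Fin d → ℕ) (j : Fin n) (x : Eucl d) : ℝ :=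
  (∏ i, θ.W₁ j i ^ β i) * iteratedDeriv (∑ i, β i) σ (θ.preact j x)

theorem realize_eq_ridge : θ.realize σ = θ.ridge σ 1 0 := by
  funext x
  ext k
  simp [realize, ridge, preact, Matrix.mulVec, dotProduct]

variable {σ} {m : ℕ}

theorem continuous_preact (j : Fin n) : Continuous (θ.preact j) := by
  unfold preact
  fun_prop

theorem continuous_ridge (hσ : ContDiff ℝ (m : WithTop ℕ∞) σ) (p : Fin n → ℝ) {s : ℕ}
    (hs : s ≤ m) : Continuous (θ.ridge σ p s) := by
  have h1 : Continuous (iteratedDeriv s σ) :=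
    hσ.continuous_iteratedDeriv s (by exact_mod_cast hs)
  have h2 := fun j => h1.comp (θ.continuous_preact j)
  unfold ridge
  refine (PiLp.continuous_toLp 2 _).comp (continuous_pi fun k => ?_)
  refine Continuous.add (continuous_finsetSum _ fun j _ => ?_) continuous_const
  exact continuous_const.mul (continuous_const.mul (h2 j))

/-- Ridge sums are closed under differentiation: the chain rule puts a factor `θ.W₁ j i` into `p j`
and raises the order of `σ`, while the bias drops out. -/
theorem hasLineDerivAt_ridge (hσ : ContDiff ℝ (m : WithTop ℕ∞) σ) (p : Fin n → ℝ) {s : ℕ}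
    (hs : s < m) (i : Fin d) (x : Eucl d) :
    HasLineDerivAt ℝ (θ.ridge σ p s) (θ.ridge σ (fun j => p j * θ.W₁ j i) (s + 1) x) x
      (EuclideanSpace.single i (1 : ℝ)) := by
  have hpre : ∀ j (t : ℝ), θ.preact j (x + t • EuclideanSpace.single i (1 : ℝ))
      = θ.preact j x + t * θ.W₁ j i := by
    intro j t
    simp [preact, mul_add, Finset.sum_add_distrib, PiLp.single_apply]
    ring
  have hpd : ∀ j, HasDerivAt (fun t : ℝ => iteratedDeriv s σ (θ.preact j x + t * θ.W₁ j i))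
      (iteratedDeriv (s + 1) σ (θ.preact j x) * θ.W₁ j i) 0 := by
    intro j
    have h1 : DifferentiableAt ℝ (iteratedDeriv s σ) (θ.preact j x + 0 * θ.W₁ j i) :=
      (hσ.differentiable_iteratedDeriv s (by exact_mod_cast hs)).differentiableAt
    have h2 : HasDerivAt (fun t : ℝ => θ.preact j x + t * θ.W₁ j i) (θ.W₁ j i) 0 := by
      simpa using ((hasDerivAt_id (0 : ℝ)).mul_const (θ.W₁ j i)).const_add (θ.preact j x)
    have h3 := h1.hasDerivAt.comp (0 : ℝ) h2
    rw [← iteratedDeriv_succ] at h3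
    simpa [Function.comp_def] using h3
  have hpi : HasDerivAt (fun t : ℝ => fun k => ∑ j, θ.W₂ k j * (p j * iteratedDeriv s σ
        (θ.preact j x + t * θ.W₁ j i)) + if s = 0 then θ.b₂ k else 0)
      (fun k => ∑ j, θ.W₂ k j * (p j * (iteratedDeriv (s + 1) σ (θ.preact j x) * θ.W₁ j i)))
      0 := by
    rw [hasDerivAt_pi]
    intro k
    refine HasDerivAt.add_const _ (HasDerivAt.fun_sum fun j _ => ?_)
    exact ((hpd j).const_mul _).const_mul _
  have key := ((PiLp.continuousLinearEquiv 2 ℝ (fun _ : Fin c => ℝ)).symm.hasFDerivAt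
    (x := _)).comp_hasDerivAt (0 : ℝ) hpi
  unfold HasLineDerivAt
  convert key using 1
  · funext t
    ext k
    simp [ridge, hpre]
  · ext k
    simp only [ridge, Nat.add_eq_zero_iff, one_ne_zero, and_false, if_false, add_zero]
    simp
    refine Finset.sum_congr rfl fun j _ => ?_
    ring

variable {Ω : Set (Eucl d)}

theorem partialDeriv_eqOn_ridge (hσ : ContDiff ℝ (m : WithTop ℕ∞) σ) (hΩ : IsOpen Ω)
    {g : Eucl d → Eucl c} {p : Fin n → ℝ} {s : ℕ} (hs : s < m) (hg : Set.EqOn g (θ.ridge σ p s) Ω)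
    (i : Fin d) :
    Set.EqOn (partialDeriv i g) (θ.ridge σ (fun j => p j * θ.W₁ j i) (s + 1)) Ω := by
  intro x hx
  -- Since `Ω` is open, equality on `Ω` is equality of germs; nothing is needed of `g` outside `Ω`.
  exact ((θ.hasLineDerivAt_ridge hσ p hs i x).congr_of_eventuallyEq
    (Filter.eventuallyEq_of_mem (hΩ.mem_nhds hx) hg)).lineDeriv

theorem iterate_partialDeriv_eqOn_ridge (hσ : ContDiff ℝ (m : WithTop ℕ∞) σ) (hΩ : IsOpen Ω)
    {g : Eucl d → Eucl c} {p : Fin n → ℝ} {s : ℕ} (hg : Set.EqOn g (θ.ridge σ p s) Ω)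
    (i : Fin d) (t : ℕ) (hs : s + t ≤ m) :
    Set.EqOn ((partialDeriv i)^[t] g) (θ.ridge σ (fun j => p j * θ.W₁ j i ^ t) (s + t)) Ω := by
  induction t with
  | zero => simpa using hg
  | succ t ih =>
    rw [Function.iterate_succ_apply']
    have h := θ.partialDeriv_eqOn_ridge hσ hΩ (by omega) (ih (by omega)) i
    simpa only [pow_succ, mul_assoc, add_assoc] using h

/-- An arbitrary list replaces `List.finRange d` to allow induction. -/
theorem foldr_partialDeriv_eqOn_ridge (hσ : ContDiff ℝ (m : WithTop ℕ∞) σ) (hΩ : IsOpen Ω)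
    {g : Eucl d → Eucl c} (hg : Set.EqOn g (θ.ridge σ 1 0) Ω) (β : Fin d → ℕ) (L : List (Fin d))
    (hL : (L.map β).sum ≤ m) :
    Set.EqOn (L.foldr (fun i h => (partialDeriv i)^[β i] h) g)
      (θ.ridge σ (fun j => (L.map fun i => θ.W₁ j i ^ β i).prod) (L.map β).sum) Ω := by
  induction L with
  | nil => exact hg
  | cons i L ih =>
    simp only [List.map_cons, List.sum_cons] at hL
    have h := θ.iterate_partialDeriv_eqOn_ridge hσ hΩ (ih (by omega)) i (β i) (by omega)
    simpa only [List.foldr_cons, List.map_cons, List.sum_cons, List.prod_cons, mul_comm,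
      add_comm] using h

theorem zeroExt_onClosure_eqOn :
    Set.EqOn (zeroExt (θ.onClosure σ Ω)) (θ.realize σ) (closure Ω) := by
  intro x hx
  simp [zeroExt, onClosure, hx]

theorem multiDeriv_onClosure_eqOn (hσ : ContDiff ℝ (m : WithTop ℕ∞) σ) (hΩ : IsOpen Ω)
    {β : Fin d → ℕ} (hβ : ∑ i, β i ≤ m) :
    Set.EqOn (multiDeriv β (zeroExt (θ.onClosure σ Ω)))
      (θ.ridge σ (fun j => ∏ i, θ.W₁ j i ^ β i) (∑ i, β i)) Ω := by
  have hg : Set.EqOn (zeroExt (θ.onClosure σ Ω)) (θ.ridge σ 1 0) Ω := by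
    rw [← realize_eq_ridge]
    exact θ.zeroExt_onClosure_eqOn.mono subset_closure
  simp only [Fin.sum_univ_def, Fin.prod_univ_def] at hβ ⊢
  exact θ.foldr_partialDeriv_eqOn_ridge hσ hΩ hg β (List.finRange d) hβ

/-- The derivatives of a network on `closure Ω`, including the traces at the boundary. -/
theorem derivAt_onClosure (hσ : ContDiff ℝ (m : WithTop ℕ∞) σ) (hΩ : IsOpen Ω)
    {β : Fin d → ℕ} (hβ : ∑ i, β i ≤ m) {z : Eucl d} (hz : z ∈ closure Ω) :
    derivAt β (θ.onClosure σ Ω) z = WithLp.toLp 2 (fun k => ∑ j, θ.W₂ k j * θ.unitDeriv σ β j z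
      + if ∑ i, β i = 0 then θ.b₂ k else 0) := by
  change _ = θ.ridge σ (fun j => ∏ i, θ.W₁ j i ^ β i) (∑ i, β i) z
  have h := θ.multiDeriv_onClosure_eqOn hσ hΩ hβ
  unfold derivAt
  split_ifs with hzΩ
  · exact h hzΩ
  -- The ridge sum is continuous on the whole space, so the trace is its value at `z`.
  · have : (𝓝[Ω] z).NeBot := mem_closure_iff_nhdsWithin_neBot.mp hz
    have hlim := ((θ.continuous_ridge hσ (fun j => ∏ i, θ.W₁ j i ^ β i) hβ).tendsto z).mono_left
      (nhdsWithin_le_nhds (s := Ω))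
    exact (hlim.congr' (Filter.eventuallyEq_of_mem self_mem_nhdsWithin h.symm)).limUnder_eq

theorem realize_eq_unitDeriv (x : Eucl d) :
    θ.realize σ x = WithLp.toLp 2 (fun k => ∑ j, θ.W₂ k j * θ.unitDeriv σ 0 j x + θ.b₂ k) := by
  rw [realize_eq_ridge]
  ext k
  simp [ridge, unitDeriv]

end ShallowNet

/-! ### Dependence of the loss on jets, and reduction of the width. -/

namespace ADPINN

variable {d c cF cB : ℕ} (P : ADPINN d c cF cB)

/-- Index set of the derivatives entering the loss. -/
abbrev JetIdx : Type := (P.Ωh × MultiIdx d P.rF) ⊕ (P.Γh × MultiIdx d P.rB)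

/-- The collocation point of an index. -/
def JetIdx.point {P : ADPINN d c cF cB} : P.JetIdx → Eucl d := Sum.elim (·.1.1) (·.1.1)

/-- The multi-index of an index. -/
def JetIdx.order {P : ADPINN d c cF cB} : P.JetIdx → Fin d → ℕ := Sum.elim (·.2.1) (·.2.1)

theorem natCard_jetIdx_le (hd : 1 ≤ d) : Nat.card P.JetIdx ≤ P.ell.choose d := by
  rw [Nat.card_sum, Nat.card_prod, Nat.card_prod, Nat.card_eq_finsetCard, Nat.card_eq_finsetCard]
  exact (Nat.add_le_add
    ((Nat.mul_le_mul_left _ (natCard_multiIdx_le d P.rF)).trans (mul_choose_le hd _ _))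
    ((Nat.mul_le_mul_left _ (natCard_multiIdx_le d P.rB)).trans (mul_choose_le hd _ _))).trans
    (choose_add_choose_le hd _ _)

theorem le_ell : d ≤ P.ell := by
  have h := Nat.mul_le_mul_right (d + P.rF) P.Ωh_nonempty.card_pos
  unfold ell
  omega

theorem rF_le : P.rF ≤ P.ell - d := by
  have h := Nat.mul_le_mul_right (d + P.rF) P.Ωh_nonempty.card_pos
  unfold ell
  omega

theorem rB_le : P.rB ≤ P.ell - d := by
  have h := Nat.mul_le_mul_right (d + P.rB) P.Γh_nonempty.card_pos
  unfold ell
  omega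

theorem mem_closure_of_mem_Ωh {z : Eucl d} (hz : z ∈ P.Ωh) : z ∈ closure P.Ω :=
  subset_closure (P.Ωh_subset hz)

theorem mem_closure_of_mem_Γh {z : Eucl d} (hz : z ∈ P.Γh) : z ∈ closure P.Ω :=
  frontier_subset_closure (P.Γ_subset (P.Γh_subset hz))

/-- Two functions with the same derivatives at the collocation points and the same values at the
observation points have the same loss. -/
theorem loss_congr {u v : closure P.Ω → Eucl c}
    (hF : ∀ z ∈ P.Ωh, ∀ β : MultiIdx d P.rF, derivAt β.1 u z = derivAt β.1 v z)
    (hB : ∀ z ∈ P.Γh, ∀ β : MultiIdx d P.rB, derivAt β.1 u z = derivAt β.1 v z)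
    (hD : ∀ z ∈ P.Dh, P.valueAt u z = P.valueAt v z) : P.loss u = P.loss v := by
  unfold loss
  congr 1
  · congr 2
    · refine Finset.sum_congr rfl fun z hz => ?_
      simp only [interiorOp, hF z hz]
    · refine Finset.sum_congr rfl fun z hz => ?_
      simp only [boundaryOp, hB z hz]
  · congr 1
    refine Finset.sum_congr rfl fun z hz => ?_
    rw [hD z hz]

/-- Networks whose hidden units have the same combined jets at the collocation points, and which
have the same output bias, have the same loss. -/
theorem loss_onClosure_congr {σ : ℝ → ℝ} (hσ : ContDiff ℝ ((P.ell - d : ℕ) : WithTop ℕ∞) σ)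
    {n n' : ℕ} (θ : ShallowNet d n c) (θ' : ShallowNet d n' c) (hb : θ.b₂ = θ'.b₂)
    (h : ∀ k (q : P.JetIdx), ∑ j, θ.W₂ k j * θ.unitDeriv σ q.order j q.point
      = ∑ j, θ'.W₂ k j * θ'.unitDeriv σ q.order j q.point) :
    P.loss (θ.onClosure σ P.Ω) = P.loss (θ'.onClosure σ P.Ω) := by
  refine P.loss_congr (fun z hz β => ?_) (fun z hz β => ?_) (fun z hz => ?_)
  · have hβ := β.2.trans P.rF_le
    have hz' := P.mem_closure_of_mem_Ωh hz
    rw [θ.derivAt_onClosure hσ P.isOpen hβ hz', θ'.derivAt_onClosure hσ P.isOpen hβ hz', hb]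
    ext k
    exact congrArg (· + _) (h k (Sum.inl (⟨z, hz⟩, β)))
  · have hβ := β.2.trans P.rB_le
    have hz' := P.mem_closure_of_mem_Γh hz
    rw [θ.derivAt_onClosure hσ P.isOpen hβ hz', θ'.derivAt_onClosure hσ P.isOpen hβ hz', hb]
    ext k
    exact congrArg (· + _) (h k (Sum.inr (⟨z, hz⟩, β)))
  -- Observation points are collocation points, so the values are jet entries with `β = 0` and need
  -- no further indices.
  · unfold valueAt
    rcases P.Dh_subset hz with hz | hz
    · have hz' := P.mem_closure_of_mem_Ωh hz
      rw [θ.zeroExt_onClosure_eqOn hz', θ'.zeroExt_onClosure_eqOn hz', θ.realize_eq_unitDeriv,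
        θ'.realize_eq_unitDeriv, hb]
      ext k
      exact congrArg (· + _) (h k (Sum.inl (⟨z, hz⟩, ⟨0, by simp⟩)))
    · have hz' := P.mem_closure_of_mem_Γh hz
      rw [θ.zeroExt_onClosure_eqOn hz', θ'.zeroExt_onClosure_eqOn hz', θ.realize_eq_unitDeriv,
        θ'.realize_eq_unitDeriv, hb]
      ext k
      exact congrArg (· + _) (h k (Sum.inr (⟨z, hz⟩, ⟨0, by simp⟩)))

/-- Any network can be replaced by one with `N` hidden units and the same loss, as soon as `N` is
at least the number of derivatives entering the loss. The hidden units are selected among those of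
the given network. -/
theorem exists_onClosure_loss_eq {σ : ℝ → ℝ}
    (hσ : ContDiff ℝ ((P.ell - d : ℕ) : WithTop ℕ∞) σ) {n N : ℕ} (hn : 0 < n)
    (hN : Nat.card P.JetIdx ≤ N) (θ : ShallowNet d n c) :
    ∃ θ' : ShallowNet d N c, P.loss (θ'.onClosure σ P.Ω) = P.loss (θ.onClosure σ P.Ω) := by
  have := Fintype.ofFinite P.JetIdx
  let Φ : Fin n → P.JetIdx → ℝ := fun j q => θ.unitDeriv σ q.order j q.point
  obtain ⟨τ, hτ⟩ := exists_comp_span_eq (N := N) hn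
    (by rwa [Module.finrank_fintype_fun_eq_card, ← Nat.card_eq_fintype_card]) Φ
  -- One selection `τ` serves all output components; only the weights depend on `k`.
  have hmem : ∀ k, ∃ w : Fin N → ℝ, ∑ l, w l • Φ (τ l) = ∑ j, θ.W₂ k j • Φ j := fun k =>
    (Submodule.mem_span_range_iff_exists_fun ℝ).mp (hτ (Submodule.sum_mem _ fun j _ =>
      Submodule.smul_mem _ _ (Submodule.subset_span ⟨j, rfl⟩)))
  choose w hw using hmem
  refine ⟨⟨fun l => θ.W₁ (τ l), fun l => θ.b₁ (τ l), w, θ.b₂⟩,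
    P.loss_onClosure_congr hσ _ _ rfl fun k q => ?_⟩
  simpa [Φ, ShallowNet.unitDeriv, ShallowNet.preact] using congrFun (hw k) q

end ADPINN

theorem mainTheorem2 {d c cF cB : ℕ} (hd : 1 ≤ d) (hc : 1 ≤ c) (P : ADPINN d c cF cB)
    (σ : ℝ → ℝ) (hσ : ContDiff ℝ ((P.ell - d : ℕ) : WithTop ℕ∞) σ)
    (a : ℝ) (ha : ∀ k : ℕ, k ≤ P.ell - d → iteratedDeriv k σ a ≠ 0)
    (hmin : ∃ u : closure P.Ω → Eucl c, P.Solves σ u) :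
    ∃ θ : ShallowNet d (c * P.ell.choose d) c,
      θ.onClosure σ P.Ω ∈ networkClassOfSize c P.Ω σ
        (c * P.ell.choose d * (d + 1) + c * (c * P.ell.choose d + 1)) ∧
      P.Solves σ (θ.onClosure σ P.Ω) := by
  obtain ⟨_, ⟨n, hn, θ, rfl⟩, hle⟩ := hmin
  have hpos : 0 < c * P.ell.choose d := Nat.mul_pos hc (Nat.choose_pos P.le_ell)
  -- `P.ell.choose d` units already suffice; the factor `c` is absorbed by repeated units.
  obtain ⟨θ', hθ'⟩ := P.exists_onClosure_loss_eq hσ hn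
    ((P.natCard_jetIdx_le hd).trans (Nat.le_mul_of_pos_left _ hc)) θ
  exact ⟨θ', ⟨_, hpos, rfl, θ', rfl⟩, ⟨_, hpos, θ', rfl⟩, fun v hv => hθ'.trans_le (hle v hv)⟩
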